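/- Let $\mathcal X,\mathcal Y$ be finite non-empty alphabets, $W$ a discrete memoryless channel from $\mathcal X$ to $\mathcal Y$, and $q:\mathcal X\times\mathcal Y\to\mathbb R$ a metric. Logarithms are natural. **Setup.** A code $\mathcal C_n$ of block length $n$ with $|\mathcal C_n|=M_n$ messages maps each $m\in\{1,\dots,M_n\}$ to a codeword $\mathbf x_m\in\mathcal X^n$. The codeword is sent over $W^n$. Each output symbol $y_i$ is then replaced by $z_i\in\mathcal Y$, drawn independently over $i$ from $f(\cdot|y_i)$, where $f=P_{Z|Y}$ is a (possibly stochastic) pre-processing channel from $\mathcal Y$ to $\mathcal Y$. From $\mathbf z$ the decoder chooses the message $k$ that maximizes $q(\mathbf x_k,\mathbf z)=\frac1n\sum_{i=1}^n q(x_{k,i},z_i)$; an error occurs if the decoded message is not the transmitted one or if there are several maximizers. Let $P_e(W,\mathcal C_n,q,f)$ be the error probability averaged over equiprobable messages. * A rate $R>0$ is achievable with pre-processing if there are codes $\mathcal C_n$ with $|\mathcal C_n|>e^{nR}$ and $\lim_{n\to\infty}\min_f P_e(W,\mathcal C_n,q,f)=0$. The capacity $C_q^{pre}(W)$ is the supremum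 of all achievable rates ($0$ if there are none). Let $\bar C_q^{pre}(W)\le C_q^{pre}(W)$ be the same supremum when it is required instead that $\lim_n P_e(W,\mathcal C_n,q,f)=0$ for a single $f$ that does not depend on $n$. * For $f$ fixed, $E\in[0,\infty]$ is an achievable error exponent at rate $R$ if for every $\delta>0$ there are codes $\mathcal C_n$ with $|\mathcal C_n|\ge e^{n(R-\delta)}$ and $\limsup_{n\to\infty}-\frac1n\log P_e(W,\mathcal C_n,q,f)\ge E$ (with $-\log 0=\infty$). The reliability function $E_q^{pre}(R,W)$ is the supremum over all $f$ and all achievable exponents at rate $R$. **Bounds.** For distributions $P_X$ on $\mathcal X$ and channels $P_{Z|Y}$ from $\mathcal Y$ to $\mathcal Y$ let $(X,Y,Z)\sim P_X\times W\times P_{Z|Y}$, so that $P_{XZ}(x,z)=\sum_y P_X(x)W(y|x)P_{Z|Y}(z|y)$. Define $$R^{pre}_{LM,q}(W)=\max_{P_X}\max_{P_{Z|Y}}\ \min_{\substack{P_{X'|Z}:\ P_{X'}=P_X\\ \mathbb E q(X',Z)\ge\mathbb E q(X,Z)}} I(X';Z),$$ where $(X',Z)\sim P_Z\times P_{X'|Z}$,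 and, with $|t|_+=\max\{0,t\}$, $$E^{pre}_{LM,q}(R,W)=\max_{P_{Z|Y},\,P_X}\ \min_{V_{XZ},\,V_{X'Z}}\Big[D(V_{XZ}\|P_{XZ})+\big|I_V(X';Z)-R\big|_+\Big],$$ where the minimum is over all pairs of distributions $V_{XZ},V_{X'Z}$ on $\mathcal X\times\mathcal Y$ with the same $Z$-marginal such that $V_{X'}=V_X=P_X$ and $\mathbb E_V[q(X',Z)]\ge\mathbb E_V[q(X,Z)]$. **Theorem.** For every DMC $W$, every metric $q$ and every $R\in\mathbb R$, $$C_q^{pre}(W)\ \ge\ R^{pre}_{LM,q}(W),\qquad E_q^{pre}(R,W)\ \ge\ E^{pre}_{LM,q}(R,W),$$ and the first bound holds also with $\bar C_q^{pre}(W)$ in place of $C_q^{pre}(W)$. -/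

import Mathlib

open scoped ENNReal

noncomputable section

namespace MismatchPre

/-- A channel (stochastic matrix) from `A` to `B`: `K a b` is the conditional probability of the
output `b` given the input `a`. Channels `W` from `X` to `Y` and (possibly stochastic) symbolwise
pre-processing functions `P_{Z|Y}` from `Y` to `Y` are both of this form. -/
abbrev Channel (A B : Type*) [Fintype B] : Type _ := A → stdSimplex ℝ B

/-- The memoryless extension `K^n(b | a) = ∏ i, K (b i | a i)`. -/
def Channel.pow {A B : Type*} [Fintype B] (K : Channel A B) {n : ℕ}
    (a : Fin n → A) (b : Fin n → B) : ℝ :=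
  ∏ i, K (a i) (b i)

/-! ### Codes and probability of error -/

/-- A code of block length `n`: a number `M` of messages and an encoder, which maps each message
to a codeword in `X ^ n`. -/
structure Code (X : Type*) (n : ℕ) where
  /-- the number of messages -/
  M : ℕ
  /-- the encoder -/
  enc : Fin M → Fin n → X

/-- The accumulated (additive) metric `q(x, z) = (1 / n) ∑ i, q (x i, z i)`. -/
def addMetric {X Y : Type*} (q : X → Y → ℝ) {n : ℕ} (x : Fin n → X) (z : Fin n → Y) : ℝ :=
  (1 / (n : ℝ)) * ∑ i, q (x i) (z i)

/-- Message `m` is decoded correctly from the decoder input `z`: the transmitted codeword is the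
unique maximizer of the accumulated metric. Ties count as errors. -/
def Code.Correct {X Y : Type*} {n : ℕ} (C : Code X n) (q : X → Y → ℝ) (m : Fin C.M)
    (z : Fin n → Y) : Prop :=
  ∀ k : Fin C.M, k ≠ m → addMetric q (C.enc k) z < addMetric q (C.enc m) z

open Classical in
/-- The average probability of error of the code `C` over the channel `W` when each output symbol
`y i` is replaced by `z i`, drawn from `f (y i)` independently over time, before decoding with the
metric `q`. -/
def errorProb {X Y : Type*} [Fintype Y] (W : Channel X Y) {n : ℕ} (C : Code X n)
    (q : X → Y → ℝ) (f : Channel Y Y) : ℝ :=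
  ∑ m : Fin C.M, (1 / (C.M : ℝ)) *
    ∑ y : Fin n → Y, W.pow (C.enc m) y *
      ∑ z : Fin n → Y, f.pow y z * (if C.Correct q m z then 0 else 1)

/-! ### Capacity -/

/-- `R` is achievable with pre-processing: there are codes with more than `e ^ (n R)` messages
for which the error probability, minimized over the symbolwise pre-processing, vanishes. -/
def IsAchievable {X Y : Type*} [Fintype Y] (W : Channel X Y) (q : X → Y → ℝ) (R : ℝ) : Prop :=
  0 < R ∧ ∃ C : (n : ℕ) → Code X n,
    (∀ n : ℕ, Real.exp (n * R) < ((C n).M : ℝ)) ∧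
    Filter.Tendsto (fun n => ⨅ f : Channel Y Y, errorProb W (C n) q f) Filter.atTop (nhds 0)

/-- `R` is achievable with one pre-processing function, the same for all block lengths. -/
def IsAchievableFixed {X Y : Type*} [Fintype Y] (W : Channel X Y) (q : X → Y → ℝ) (R : ℝ) :
    Prop :=
  0 < R ∧ ∃ (C : (n : ℕ) → Code X n) (f : Channel Y Y),
    (∀ n : ℕ, Real.exp (n * R) < ((C n).M : ℝ)) ∧
    Filter.Tendsto (fun n => errorProb W (C n) q f) Filter.atTop (nhds 0)

/-- The mismatch capacity with pre-processing, in nats: the supremum of all achievable rates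
(`0` if no positive rate is achievable). -/
def capacity {X Y : Type*} [Fintype Y] (W : Channel X Y) (q : X → Y → ℝ) : ℝ≥0∞ :=
  ⨆ (R : ℝ) (_ : IsAchievable W q R), ENNReal.ofReal R

/-- The mismatch capacity when the pre-processing function may not depend on the block length. -/
def capacityFixed {X Y : Type*} [Fintype Y] (W : Channel X Y) (q : X → Y → ℝ) : ℝ≥0∞ :=
  ⨆ (R : ℝ) (_ : IsAchievableFixed W q R), ENNReal.ofReal R

/-! ### Reliability function -/

/-- `E` is an achievable error exponent at rate `R` with the pre-processing function `f`. Here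
`-(1 / n) log P_e` is an extended real number, equal to `+∞` if `P_e = 0` and `n ≠ 0`. -/
def IsAchievableExponent {X Y : Type*} [Fintype Y] (W : Channel X Y) (q : X → Y → ℝ)
    (f : Channel Y Y) (R : ℝ) (E : ℝ≥0∞) : Prop :=
  ∀ δ : ℝ, 0 < δ → ∃ C : (n : ℕ) → Code X n,
    (∀ n : ℕ, Real.exp (n * (R - δ)) ≤ ((C n).M : ℝ)) ∧
    (E : EReal) ≤ Filter.limsup
      (fun n : ℕ => -(((1 / (n : ℝ) : ℝ) : EReal) *
        ENNReal.log (ENNReal.ofReal (errorProb W (C n) q f)))) Filter.atTop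

/-- The reliability function with pre-processing: the supremum over all pre-processing functions
and all error exponents achievable with them. -/
def reliability {X Y : Type*} [Fintype Y] (R : ℝ) (W : Channel X Y) (q : X → Y → ℝ) : ℝ≥0∞ :=
  ⨆ (f : Channel Y Y) (E : ℝ≥0∞) (_ : IsAchievableExponent W q f R E), E

/-! ### Information quantities on finite alphabets -/

/-- Relative entropy `D(V ‖ P)` in nats; it is `+∞` unless `V` is absolutely continuous with
respect to `P`. -/
def relEntropy {A : Type*} [Fintype A] (V P : stdSimplex ℝ A) : ℝ≥0∞ :=
  open Classical in
  if ∀ a, P a = 0 → V a = 0 then ENNReal.ofReal (∑ a, V a * Real.log (V a / P a)) else ⊤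

/-- First marginal of a joint distribution. -/
def marg₁ {X Y : Type*} [Fintype X] [Fintype Y] (V : stdSimplex ℝ (X × Y)) (x : X) : ℝ :=
  ∑ z, V (x, z)

/-- Second marginal of a joint distribution. -/
def marg₂ {X Y : Type*} [Fintype X] [Fintype Y] (V : stdSimplex ℝ (X × Y)) (z : Y) : ℝ :=
  ∑ x, V (x, z)

/-- Mutual information `I_V(X; Z)` in nats of the joint distribution `V` of `(X, Z)`. -/
def mutualInfo {X Y : Type*} [Fintype X] [Fintype Y] (V : stdSimplex ℝ (X × Y)) : ℝ :=
  ∑ x, ∑ z, V (x, z) * Real.log (V (x, z) / (marg₁ V x * marg₂ V z))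

/-- Expected metric `E_V[q(X, Z)]`. -/
def expMetric {X Y : Type*} [Fintype X] [Fintype Y] (q : X → Y → ℝ)
    (V : stdSimplex ℝ (X × Y)) : ℝ :=
  ∑ x, ∑ z, V (x, z) * q x z

/-- The joint distribution `P_{XZ}` of `(X, Z)` when `X - Y - Z` is the Markov chain with law
`P_X × W × P_{Z|Y}`. -/
def jointXZ {X Y : Type*} [Fintype X] [Fintype Y] (P : stdSimplex ℝ X) (W : Channel X Y)
    (f : Channel Y Y) : stdSimplex ℝ (X × Y) :=
  ⟨fun p => ∑ y, P p.1 * W p.1 y * f y p.2, by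
    constructor
    · intro p
      exact Finset.sum_nonneg fun y _ =>
        mul_nonneg (mul_nonneg (P.2.1 p.1) ((W p.1).2.1 y)) ((f y).2.1 p.2)
    · rw [Fintype.sum_prod_type]
      have h : ∀ x, ∑ z, ∑ y, P x * W x y * f y z = P x := by
        intro x
        rw [Finset.sum_comm]
        have h1 : ∀ y, ∑ z, P x * W x y * f y z = P x * W x y := by
          intro y
          rw [← Finset.mul_sum]
          have := (f y).2.2
          exact (congrArg (fun t => P x * W x y * t) this).trans (mul_one _)
        simp_rw [h1]
        rw [← Finset.mul_sum]
        have := (W x).2.2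
        exact (congrArg (fun t => P x * t) this).trans (mul_one _)
      simp_rw [h]
      exact P.2.2⟩

/-! ### The single-letter bounds -/

/-- `R^pre_{LM,q}(P_X, W)`: maximum over `P_{Z|Y}` of the minimum of `I(X'; Z)` over the joint
distributions `V` of `(X', Z)` with `P_{X'} = P_X`, with `Z`-marginal `P_Z`, and with
`E q(X', Z) ≥ E q(X, Z)`. -/
def lmRateAt {X Y : Type*} [Fintype X] [Fintype Y] (P : stdSimplex ℝ X) (W : Channel X Y)
    (q : X → Y → ℝ) : ℝ≥0∞ :=
  ⨆ f : Channel Y Y, ⨅ (V : stdSimplex ℝ (X × Y)) (_ : ∀ x, marg₁ V x = P x)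
    (_ : ∀ z, marg₂ V z = marg₂ (jointXZ P W f) z)
    (_ : expMetric q (jointXZ P W f) ≤ expMetric q V), ENNReal.ofReal (mutualInfo V)

/-- `R^pre_{LM,q}(W)`: maximum of `R^pre_{LM,q}(P_X, W)` over `P_X`. -/
def lmRate {X Y : Type*} [Fintype X] [Fintype Y] (W : Channel X Y) (q : X → Y → ℝ) : ℝ≥0∞ :=
  ⨆ P : stdSimplex ℝ X, lmRateAt P W q

/-- `E^pre_{LM,q}(R, W)`: maximum over `P_{Z|Y}` and `P_X` of the minimum of
`D(V_{XZ} ‖ P_{XZ}) + |I_V(X'; Z) - R|_+` over the pairs `V = V_{XZ}`, `V' = V_{X'Z}` with a common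
`Z`-marginal, with `V_{X'} = V_X = P_X` and with `E_V q(X', Z) ≥ E_V q(X, Z)`.
Note that `ENNReal.ofReal t` is `max 0 t`. -/
def lmExponent {X Y : Type*} [Fintype X] [Fintype Y] (R : ℝ) (W : Channel X Y)
    (q : X → Y → ℝ) : ℝ≥0∞ :=
  ⨆ (f : Channel Y Y) (P : stdSimplex ℝ X),
    ⨅ (V : stdSimplex ℝ (X × Y)) (V' : stdSimplex ℝ (X × Y))
      (_ : ∀ x, marg₁ V x = P x) (_ : ∀ x, marg₁ V' x = P x)
      (_ : ∀ z, marg₂ V' z = marg₂ V z) (_ : expMetric q V ≤ expMetric q V'),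
      relEntropy V (jointXZ P W f) + ENNReal.ofReal (mutualInfo V' - R)

end MismatchPre

end

/-!
Both bounds are proved by random coding with a single pre-processing function `f`, for which `W`
followed by `f` is again a memoryless channel, and `P_{XZ}` is the law of one input and its decoder
input.

*Ensemble.* The codewords are drawn independently from the product law `P ^ n` conditioned on the
words whose empirical distribution is within `ε` of `P`. By Chebyshev's inequality
(`eventually_half_le_sum_isTypical`) this conditioning at most doubles the masses, and no rational
approximation of `P` by types is needed.

*Types.* A word `s` with empirical distribution `V` has mass
`J ^ n (s) = V ^ n (s) exp (-n D(V ‖ J))`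
under a product law `J`, and there are at most polynomially many empirical distributions. Applied to
the pair (sent word, output) with `J = P_{XZ}`, this gives `sum_prod_mul_exp_klSum_le`; applied to a
competing word with a fixed output, it gives `sum_prod_mul_exp_mutualInfo_le`, which bounds the
probability of the joint empirical distribution `V'` by `exp (-n I_{V'}(X'; Z))`. Bounding the
probability of a confusion by the smaller of `1` and the union bound (`exists_code_of_union_bound`)
yields codes with error probability at most a polynomial times `exp (-n β)`, where `β` is a lower
bound of `D(V ‖ P_{XZ}) + |I_{V'}(X'; Z) - R|₊` over the pairs `(V, V')` with equal `Z`-marginals,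
`E q(X', Z) ≥ E q(X, Z)` and `X`-marginals within `ε` of `P` (`exists_code_errorProb_le`).

*Compactness.* If that functional exceeds `a` on the pairs whose `X`-marginals equal `P`, then for
some `ε > 0` it is at least `a + ε` on the pairs whose `X`-marginals are `ε`-close to `P`
(`exists_uniform_gap`). So there are codes with an error exponent larger than `a`
(`exists_codes_of_lt_exponent`). The bound on the reliability function follows with `a` slightly
below the single-letter exponent. The capacity bound is the case `a = 0`: at a rate below
the single-letter rate the functional is positive, because `D(V ‖ P_{XZ}) = 0` forces `V = P_{XZ}`.
-/

noncomputable section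

namespace MismatchPre

/-! ### Moments under product weights -/

lemma sum_prod_eq_prod_sum {ι α : Type*} [Fintype ι] [DecidableEq ι] [Fintype α]
    (u : ι → α → ℝ) : ∑ c : ι → α, ∏ i, u i (c i) = ∏ i, ∑ a, u i a := by
  rw [Finset.prod_univ_sum, Fintype.piFinset_univ]

lemma sum_prod_eq_one {ι α : Type*} [Fintype ι] [DecidableEq ι] [Fintype α]
    {Q : α → ℝ} (hQ : ∑ a, Q a = 1) : ∑ c : ι → α, ∏ i, Q (c i) = 1 := by
  rw [sum_prod_eq_prod_sum (fun _ => Q)]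
  simp [hQ]

lemma sum_prod_mul_apply {ι α : Type*} [Fintype ι] [DecidableEq ι] [Fintype α]
    {Q : α → ℝ} (hQ : ∑ a, Q a = 1) (m : ι) (g : α → ℝ) :
    ∑ c : ι → α, (∏ i, Q (c i)) * g (c m) = ∑ a, Q a * g a := by
  have h1 : ∀ c : ι → α, (∏ i, Q (c i)) * g (c m)
      = ∏ i, Q (c i) * (if i = m then g (c i) else 1) := by
    intro c
    rw [Finset.prod_mul_distrib, Finset.prod_ite_eq' Finset.univ m (fun i => g (c i))]
    simp
  simp_rw [h1]
  rw [sum_prod_eq_prod_sum (fun i a => Q a * (if i = m then g a else 1)),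
    Finset.prod_eq_single m]
  · simp
  · intro i _ hi
    simp [hi, hQ]
  · simp

lemma sum_prod_mul_apply₂ {ι α : Type*} [Fintype ι] [DecidableEq ι] [Fintype α]
    {Q : α → ℝ} (hQ : ∑ a, Q a = 1) {m k : ι} (hmk : m ≠ k) (g : α → α → ℝ) :
    ∑ c : ι → α, (∏ i, Q (c i)) * g (c m) (c k) = ∑ a, Q a * ∑ b, Q b * g a b := by
  classical
  -- The case `g a b = u a * v b` factorizes over the coordinates.
  have key : ∀ u v : α → ℝ, ∑ c : ι → α, (∏ i, Q (c i)) * (u (c m) * v (c k))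
      = (∑ a, Q a * u a) * ∑ b, Q b * v b := by
    intro u v
    have h1 : ∀ c : ι → α, (∏ i, Q (c i)) * (u (c m) * v (c k))
        = ∏ i, Q (c i) * ((if i = m then u (c i) else 1) * (if i = k then v (c i) else 1)) := by
      intro c
      rw [Finset.prod_mul_distrib, Finset.prod_mul_distrib,
        Finset.prod_ite_eq' Finset.univ m (fun i => u (c i)),
        Finset.prod_ite_eq' Finset.univ k (fun i => v (c i))]
      simp
    simp_rw [h1]
    rw [sum_prod_eq_prod_sum
        (fun i a => Q a * ((if i = m then u a else 1) * (if i = k then v a else 1))),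
      Finset.prod_eq_mul m k hmk]
    · simp [hmk, hmk.symm]
    · intro i _ hi
      simp [hi.1, hi.2, hQ]
    · simp
    · simp
  have h2 : ∀ c : ι → α, (∏ i, Q (c i)) * g (c m) (c k) = ∑ a, (∏ i, Q (c i)) *
      ((if c m = a then 1 else 0) * g a (c k)) := by
    intro c
    rw [← Finset.mul_sum]
    simp
  simp_rw [h2]
  rw [Finset.sum_comm]
  refine Finset.sum_congr rfl fun a _ => ?_
  rw [key (fun b => if b = a then 1 else 0) (fun b => g a b)]
  simp

/-! ### Random coding -/

open Classical in
/-- Random coding with pairwise independent competitors. When the codewords are drawn independently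
from `Q`, the probability of a confusion given the sent word `x` and the output `z` is bounded
by `1` and by the union bound; `b x z` only has to dominate one of the two. -/
lemma exists_code_of_union_bound {α Z : Type*} [Fintype α] [Fintype Z] {Q : α → ℝ}
    (hQ0 : ∀ a, 0 ≤ Q a) (hQ : ∑ a, Q a = 1) {K : α → Z → ℝ} (hK : ∀ a z, 0 ≤ K a z)
    (bad : α → α → Z → Prop) {b : α → Z → ℝ} (M : ℕ) (hM : 0 < M)
    (hb : ∀ x z, Q x ≠ 0 → K x z ≠ 0 →
      1 ≤ b x z ∨ M * ∑ x', Q x' * (if bad x x' z then 1 else 0) ≤ b x z) :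
    ∃ c : Fin M → α, ∑ m, (1 / (M : ℝ)) *
      ∑ z, K (c m) z * (if ∃ k, k ≠ m ∧ bad (c m) (c k) z then 1 else 0)
        ≤ ∑ x, Q x * ∑ z, K x z * b x z := by
  set B := ∑ x, Q x * ∑ z, K x z * b x z with hB
  set F : (Fin M → α) → ℝ := fun c => ∑ m, (1 / (M : ℝ)) *
      ∑ z, K (c m) z * (if ∃ k, k ≠ m ∧ bad (c m) (c k) z then 1 else 0) with hF
  have hw0 : ∀ c : Fin M → α, 0 ≤ ∏ i, Q (c i) := fun c => Finset.prod_nonneg fun i _ => hQ0 _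
  have hMpos : (0 : ℝ) < M := by exact_mod_cast hM
  -- The contribution of one message.
  have hm : ∀ m : Fin M, ∑ c : Fin M → α, (∏ i, Q (c i)) *
      ∑ z, K (c m) z * (if ∃ k, k ≠ m ∧ bad (c m) (c k) z then 1 else 0) ≤ B := by
    intro m
    have hpt : ∀ c : Fin M → α, ∑ z, K (c m) z *
        (if ∃ k, k ≠ m ∧ bad (c m) (c k) z then (1 : ℝ) else 0) ≤
        (∑ z, K (c m) z * (if 1 ≤ b (c m) z then b (c m) z else 0)) +
        ∑ k ∈ Finset.univ.erase m, ∑ z, K (c m) z * (if 1 ≤ b (c m) z then 0 else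
            if bad (c m) (c k) z then 1 else 0) := by
      intro c
      rw [Finset.sum_comm, ← Finset.sum_add_distrib]
      refine Finset.sum_le_sum fun z _ => ?_
      rw [← Finset.mul_sum, ← mul_add]
      refine mul_le_mul_of_nonneg_left ?_ (hK _ _)
      by_cases h1 : 1 ≤ b (c m) z
      · simp only [h1, if_true, Finset.sum_const_zero, add_zero]
        split_ifs <;> linarith
      · simp only [h1, if_false, zero_add]
        split_ifs with h2
        · obtain ⟨k, hk, hk2⟩ := h2
          have := Finset.single_le_sum (f := fun k => if bad (c m) (c k) z then (1 : ℝ) else 0)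
            (s := Finset.univ.erase m) (fun i _ => by positivity)
            (Finset.mem_erase.2 ⟨hk, Finset.mem_univ k⟩)
          simpa [hk2] using this
        · exact Finset.sum_nonneg fun i _ => by positivity
    calc _ ≤ ∑ c : Fin M → α, (∏ i, Q (c i)) *
          ((∑ z, K (c m) z * (if 1 ≤ b (c m) z then b (c m) z else 0)) +
        ∑ k ∈ Finset.univ.erase m, ∑ z, K (c m) z * (if 1 ≤ b (c m) z then 0 else
            if bad (c m) (c k) z then 1 else 0)) :=
          Finset.sum_le_sum fun c _ => mul_le_mul_of_nonneg_left (hpt c) (hw0 c)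
      _ = (∑ x, Q x * ∑ z, K x z * (if 1 ≤ b x z then b x z else 0)) +
          ∑ k ∈ Finset.univ.erase m, ∑ x, Q x * ∑ x', Q x' * ∑ z, K x z *
            (if 1 ≤ b x z then 0 else if bad x x' z then 1 else 0) := by
          simp_rw [mul_add, Finset.sum_add_distrib]
          rw [sum_prod_mul_apply hQ m
            (fun x => ∑ z, K x z * (if 1 ≤ b x z then b x z else 0))]
          congr 1
          simp_rw [Finset.mul_sum (s := Finset.univ.erase m)]
          rw [Finset.sum_comm]
          refine Finset.sum_congr rfl fun k hk => ?_
          exact sum_prod_mul_apply₂ hQ (Finset.ne_of_mem_erase hk).symm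
            (fun x x' => ∑ z, K x z *
              (if 1 ≤ b x z then 0 else if bad x x' z then 1 else 0))
      _ ≤ B := by
          rw [Finset.sum_const, nsmul_eq_mul, Finset.mul_sum, ← Finset.sum_add_distrib, hB]
          refine Finset.sum_le_sum fun x _ => ?_
          rw [mul_left_comm, ← mul_add]
          by_cases hQx : Q x = 0
          · simp [hQx]
          refine mul_le_mul_of_nonneg_left ?_ (hQ0 x)
          simp_rw [Finset.mul_sum (s := (Finset.univ : Finset Z))]
          rw [Finset.sum_comm, Finset.mul_sum, ← Finset.sum_add_distrib]
          refine Finset.sum_le_sum fun z _ => ?_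
          simp_rw [mul_left_comm _ (K x z)]
          rw [← Finset.mul_sum, mul_left_comm, ← mul_add]
          by_cases hKx : K x z = 0
          · simp [hKx]
          refine mul_le_mul_of_nonneg_left ?_ (hK x z)
          by_cases h1 : 1 ≤ b x z
          · simp [h1]
          · have h2 := (hb x z hQx hKx).resolve_left h1
            simp only [h1, if_false, zero_add]
            refine le_trans (mul_le_mul_of_nonneg_right ?_ ?_) h2
            · exact_mod_cast (Finset.card_le_univ _).trans (by simp)
            · exact Finset.sum_nonneg fun i _ => mul_nonneg (hQ0 _) (by positivity)
  have htot : ∑ c : Fin M → α, (∏ i, Q (c i)) * F c ≤ B := by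
    simp only [hF, Finset.mul_sum (s := (Finset.univ : Finset (Fin M)))]
    rw [Finset.sum_comm]
    simp_rw [mul_left_comm _ (1 / (M : ℝ)), ← Finset.mul_sum]
    calc _ ≤ (1 / (M : ℝ)) * ∑ m : Fin M, B := by
          refine mul_le_mul_of_nonneg_left (Finset.sum_le_sum fun m _ => ?_) (by positivity)
          simpa [Finset.mul_sum] using hm m
      _ = B := by
          simp only [Finset.sum_const, Finset.card_univ, Fintype.card_fin, nsmul_eq_mul]
          field_simp
  by_contra! hcon
  have hone : ∑ c : Fin M → α, ∏ i, Q (c i) = 1 := sum_prod_eq_one hQ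
  have : ∑ c : Fin M → α, (∏ i, Q (c i)) * B < ∑ c : Fin M → α, (∏ i, Q (c i)) * F c := by
    have hex : ∃ c : Fin M → α, 0 < ∏ i, Q (c i) := by
      by_contra! h
      have := Finset.sum_nonpos fun c (_ : c ∈ (Finset.univ : Finset (Fin M → α))) => h c
      linarith
    obtain ⟨c, hc⟩ := hex
    exact Finset.sum_lt_sum (fun c _ => mul_le_mul_of_nonneg_left (hcon c).le (hw0 c))
      ⟨c, Finset.mem_univ c, mul_lt_mul_of_pos_left (hcon c) hc⟩
  rw [← Finset.sum_mul, hone, one_mul] at this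
  linarith

/-! ### Empirical distributions -/

open Classical in
/-- The empirical distribution (type) of a word `s` of positive length `n`: the relative frequency
of each letter. -/
def empirical {A : Type*} [Fintype A] {n : ℕ} (hn : 0 < n) (s : Fin n → A) : stdSimplex ℝ A :=
  ⟨fun a => (∑ i, if s i = a then 1 else 0) / (n : ℝ), by
    constructor
    · intro a
      positivity
    · rw [← Finset.sum_div, Finset.sum_comm]
      have : (n : ℝ) ≠ 0 := by positivity
      simp [this]⟩

section
variable {A : Type*} [Fintype A] {n : ℕ} (hn : 0 < n)

open Classical in
lemma empirical_apply (s : Fin n → A) (a : A) :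
    empirical hn s a = (∑ i, if s i = a then (1 : ℝ) else 0) / (n : ℝ) := rfl

lemma sum_empirical_mul (s : Fin n → A) (φ : A → ℝ) :
    ∑ a, empirical hn s a * φ a = (∑ i, φ (s i)) / n := by
  classical
  simp_rw [empirical_apply, div_mul_eq_mul_div, Finset.sum_mul]
  rw [← Finset.sum_div, Finset.sum_comm]
  simp

lemma empirical_pos (s : Fin n → A) (i : Fin n) : 0 < empirical hn s (s i) := by
  classical
  rw [empirical_apply]
  have h1 : (1 : ℝ) ≤ ∑ j, if s j = s i then (1 : ℝ) else 0 := by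
    have := Finset.single_le_sum (f := fun j => if s j = s i then (1 : ℝ) else 0)
      (s := Finset.univ) (fun i _ => by positivity) (Finset.mem_univ i)
    simpa using this
  have : (0 : ℝ) < n := by exact_mod_cast hn
  positivity

lemma exists_of_empirical_ne_zero {s : Fin n → A} {a : A} (h : empirical hn s a ≠ 0) :
    ∃ i, s i = a := by
  classical
  by_contra! hcon
  exact h (by simp [empirical_apply, hcon])

/-- There are polynomially many empirical distributions. -/
lemma card_image_empirical_le [DecidableEq (stdSimplex ℝ A)] :
    (Finset.univ.image (empirical (A := A) hn)).card ≤ (n + 1) ^ Fintype.card A := by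
  classical
  let cnt : (Fin n → A) → A → Fin (n + 1) := fun s a =>
    ⟨(Finset.univ.filter fun i => s i = a).card,
      Nat.lt_succ_of_le ((Finset.card_le_univ _).trans (by simp))⟩
  have h : ∀ s t, cnt s = cnt t → empirical hn s = empirical hn t := by
    intro s t hst
    ext a
    have := congrArg (fun k : Fin (n + 1) => ((k : ℕ) : ℝ)) (congrFun hst a)
    simp only [cnt] at this
    rw [empirical_apply, empirical_apply, Finset.sum_boole, Finset.sum_boole, this]
  refine (Finset.card_le_card_of_forall_subsingleton (t := Finset.univ)
    (fun V k => ∃ s, empirical hn s = V ∧ cnt s = k) ?_ ?_).trans_eq (by simp)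
  · intro V hV
    obtain ⟨s, -, rfl⟩ := Finset.mem_image.1 hV
    exact ⟨cnt s, Finset.mem_univ _, s, rfl, rfl⟩
  · rintro k - V ⟨-, s, rfl, hs⟩ V' ⟨-, t, rfl, ht⟩
    exact h s t (hs.trans ht.symm)

/-- A sum of masses, each evaluated at the empirical distribution of its own word, is at most the
number of empirical distributions. -/
lemma sum_empirical_mass_le {S : Type*} [Fintype S] (τ : S → Fin n → A)
    (F : stdSimplex ℝ A → S → ℝ) (hF0 : ∀ s₀ s, 0 ≤ F (empirical hn (τ s₀)) s)
    (hF : ∀ s₀, ∑ s, F (empirical hn (τ s₀)) s ≤ 1) :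
    ∑ s, F (empirical hn (τ s)) s ≤ ((n : ℝ) + 1) ^ Fintype.card A := by
  classical
  rw [← Finset.sum_fiberwise_of_maps_to (s := Finset.univ)
    (t := Finset.univ.image fun s => empirical hn (τ s)) (g := fun s => empirical hn (τ s))
    (fun s _ => Finset.mem_image_of_mem _ (Finset.mem_univ s))]
  have h1 : ∀ V ∈ Finset.univ.image fun s => empirical hn (τ s),
      ∑ s ∈ Finset.univ.filter (fun s => empirical hn (τ s) = V), F (empirical hn (τ s)) s
        ≤ 1 := by
    intro V hV
    obtain ⟨s₀, -, rfl⟩ := Finset.mem_image.1 hV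
    refine le_trans ?_ (hF s₀)
    calc _ = ∑ s ∈ Finset.univ.filter (fun s => empirical hn (τ s) = empirical hn (τ s₀)),
          F (empirical hn (τ s₀)) s := by
          refine Finset.sum_congr rfl fun s hs => ?_
          rw [(Finset.mem_filter.1 hs).2]
      _ ≤ _ := Finset.sum_le_sum_of_subset_of_nonneg (Finset.subset_univ _)
          fun s _ _ => hF0 s₀ s
  refine (Finset.sum_le_card_nsmul _ _ _ h1).trans ?_
  rw [nsmul_eq_mul, mul_one]
  have h2 : (Finset.univ.image fun s => empirical hn (τ s)).card ≤ (n + 1) ^ Fintype.card A := by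
    refine le_trans (Finset.card_le_card ?_) (card_image_empirical_le (A := A) hn)
    intro V hV
    obtain ⟨s₀, -, rfl⟩ := Finset.mem_image.1 hV
    exact Finset.mem_image_of_mem _ (Finset.mem_univ _)
  exact_mod_cast h2

/-- The divergence `∑ a, V a * log (V a / p a)` as a real number; it agrees with the relative
entropy when `V` is absolutely continuous with respect to `p`. -/
def klSum (V p : A → ℝ) : ℝ := ∑ a, V a * Real.log (V a / p a)

/-- Gibbs' inequality, with its case of equality. -/
lemma klSum_nonneg {V p : A → ℝ} (hV0 : ∀ a, 0 ≤ V a) (hp0 : ∀ a, 0 ≤ p a)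
    (hV : ∑ a, V a = 1) (hp : ∑ a, p a ≤ 1) (hac : ∀ a, p a = 0 → V a = 0) :
    0 ≤ klSum V p ∧ (klSum V p ≤ 0 → V = p) := by
  have hterm : ∀ a, V a - p a ≤ V a * Real.log (V a / p a) ∧
      (V a * Real.log (V a / p a) ≤ V a - p a → V a = p a) := by
    intro a
    rcases (hV0 a).eq_or_lt with h | h
    · rw [← h]
      constructor
      · simpa using hp0 a
      · intro h2
        have := hp0 a
        simp at h2
        linarith
    · have hp' : 0 < p a := (hp0 a).lt_of_ne fun h' => h.ne' (hac a h'.symm)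
      have hlog : Real.log (V a / p a) = - Real.log (p a / V a) := by
        rw [← Real.log_inv, inv_div]
      have hmul : V a * (p a / V a - 1) = p a - V a := by field_simp
      constructor
      · have := mul_le_mul_of_nonneg_left (Real.log_le_sub_one_of_pos (div_pos hp' h)) h.le
        rw [hlog]
        linarith
      · intro h2
        by_contra hne
        have hne' : p a / V a ≠ 1 := fun h3 => hne ((div_eq_one_iff_eq h.ne').1 h3).symm
        have := mul_lt_mul_of_pos_left
          (Real.log_lt_sub_one_of_pos (div_pos hp' h) hne') h
        rw [hlog] at h2
        linarith
  have hsum : ∑ a, (V a - p a) ≤ klSum V p := Finset.sum_le_sum fun a _ => (hterm a).1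
  rw [Finset.sum_sub_distrib] at hsum
  refine ⟨by linarith, fun h => ?_⟩
  have heq : ∑ a, (V a - p a) = klSum V p := by
    rw [Finset.sum_sub_distrib]
    linarith
  have := (Finset.sum_eq_sum_iff_of_le fun a _ => (hterm a).1).1 heq
  funext a
  exact (hterm a).2 (this a (Finset.mem_univ a)).ge

/-- The product mass of a word in terms of its empirical distribution. -/
lemma prod_eq_prod_empirical_mul_exp (s : Fin n → A) (p : A → ℝ) (hp : ∀ i, 0 < p (s i)) :
    ∏ i, p (s i) = (∏ i, empirical hn s (s i)) *
      Real.exp (-(n * klSum (empirical hn s) p)) := by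
  have hn' : (n : ℝ) ≠ 0 := by positivity
  rw [klSum, sum_empirical_mul hn s (fun a => Real.log (empirical hn s a / p a)),
    mul_div_cancel₀ _ hn', ← Finset.sum_neg_distrib, Real.exp_sum, ← Finset.prod_mul_distrib]
  refine Finset.prod_congr rfl fun i _ => ?_
  have h1 := empirical_pos hn s i
  have h2 := hp i
  rw [← Real.log_inv, Real.exp_log (by positivity)]
  field_simp

/-- Among all product distributions, the one of its own empirical distribution gives a word the
largest mass. -/
lemma prod_le_prod_empirical (s : Fin n → A) (P : stdSimplex ℝ A) :
    ∏ i, P (s i) ≤ ∏ i, empirical hn s (s i) := by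
  have hnn : 0 ≤ ∏ i, empirical hn s (s i) :=
    Finset.prod_nonneg fun i _ => (empirical_pos hn s i).le
  by_cases h : ∀ i, 0 < P (s i)
  · rw [prod_eq_prod_empirical_mul_exp hn s P h]
    refine mul_le_of_le_one_right hnn (Real.exp_le_one_iff.2 ?_)
    have hac : ∀ a, P a = 0 → empirical hn s a = 0 := by
      intro a ha
      by_contra h3
      obtain ⟨i, rfl⟩ := exists_of_empirical_ne_zero hn h3
      exact (h i).ne' ha
    have := (klSum_nonneg (empirical hn s).2.1 P.2.1 (empirical hn s).2.2 P.2.2.le hac).1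
    have h4 : (0 : ℝ) ≤ n * klSum (empirical hn s) P := mul_nonneg (by positivity) this
    linarith
  · push Not at h
    obtain ⟨i, hi⟩ := h
    have : P (s i) = 0 := le_antisymm hi (P.2.1 _)
    rw [Finset.prod_eq_zero (Finset.mem_univ i) this]
    exact hnn

/-- Sanov-type estimate: weighting each word by `exp (n D(V_s ‖ J))`, where `V_s` is its empirical
distribution, makes its total mass at most polynomial. -/
lemma sum_prod_mul_exp_klSum_le (J : stdSimplex ℝ A) :
    ∑ s : Fin n → A, (∏ i, J (s i)) * Real.exp (n * klSum (empirical hn s) J)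
      ≤ ((n : ℝ) + 1) ^ Fintype.card A := by
  classical
  refine le_trans (Finset.sum_le_sum fun s _ => ?_)
    (sum_empirical_mass_le hn (fun s => s) (fun V s => ∏ i, V (s i))
      (fun s₀ s => Finset.prod_nonneg fun i _ => (empirical hn s₀).2.1 _)
      (fun s₀ => (sum_prod_eq_one (empirical hn s₀).2.2).le))
  by_cases h : ∀ i, 0 < J (s i)
  · rw [prod_eq_prod_empirical_mul_exp hn s J h, mul_assoc, ← Real.exp_add]
    simp
  · push Not at h
    obtain ⟨i, hi⟩ := h
    have : J (s i) = 0 := le_antisymm hi (J.2.1 _)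
    rw [Finset.prod_eq_zero (Finset.mem_univ i) this, zero_mul]
    exact Finset.prod_nonneg fun i _ => (empirical_pos hn s i).le

end

/-! ### Joint empirical distributions -/

section
variable {X Y : Type*} [Fintype X] [Fintype Y] {n : ℕ} (hn : 0 < n)

lemma marg₁_empirical (x : Fin n → X) (z : Fin n → Y) (a : X) :
    marg₁ (empirical hn fun i => (x i, z i)) a = empirical hn x a := by
  classical
  simp only [marg₁, empirical_apply]
  rw [← Finset.sum_div, Finset.sum_comm]
  congr 1
  refine Finset.sum_congr rfl fun i _ => ?_
  by_cases h : x i = a <;> simp [h]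

lemma marg₂_empirical (x : Fin n → X) (z : Fin n → Y) (b : Y) :
    marg₂ (empirical hn fun i => (x i, z i)) b = empirical hn z b := by
  classical
  simp only [marg₂, empirical_apply]
  rw [← Finset.sum_div, Finset.sum_comm]
  congr 1
  refine Finset.sum_congr rfl fun i _ => ?_
  by_cases h : z i = b <;> simp [h]

lemma expMetric_empirical (q : X → Y → ℝ) (x : Fin n → X) (z : Fin n → Y) :
    expMetric q (empirical hn fun i => (x i, z i)) = addMetric q x z := by
  rw [expMetric, ← Fintype.sum_prod_type', addMetric,
    sum_empirical_mul hn (fun i => (x i, z i)) (fun p => q p.1 p.2), one_div, inv_mul_eq_div]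

lemma mutualInfo_eq_klSum (V : stdSimplex ℝ (X × Y)) :
    mutualInfo V = klSum V (fun p => marg₁ V p.1 * marg₂ V p.2) := by
  rw [mutualInfo, klSum, Fintype.sum_prod_type]

/-- For a fixed `z`, the word `x` drawn from a product distribution has joint empirical distribution
`V` with `z` with probability of order at most `exp (-n I_V(X; Z))`. -/
lemma sum_prod_mul_exp_mutualInfo_le (P : stdSimplex ℝ X) (z : Fin n → Y) :
    ∑ x : Fin n → X, (∏ i, P (x i)) *
      Real.exp (n * mutualInfo (empirical hn fun i => (x i, z i)))
      ≤ ((n : ℝ) + 1) ^ Fintype.card (X × Y) := by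
  classical
  have hz := empirical_pos hn z
  refine le_trans (Finset.sum_le_sum fun x _ => ?_)
    (sum_empirical_mass_le hn (fun (x : Fin n → X) i => (x i, z i))
      (fun V x => ∏ i, V (x i, z i) / empirical hn z (z i))
      (fun x₀ x => Finset.prod_nonneg fun i _ =>
        div_nonneg ((empirical hn fun i => (x₀ i, z i)).2.1 _) (hz i).le)
      (fun x₀ => ?_))
  · set V := empirical hn fun i => (x i, z i) with hV
    have hx := empirical_pos hn x
    have h1 := prod_eq_prod_empirical_mul_exp hn (fun i => (x i, z i))
      (fun p => marg₁ V p.1 * marg₂ V p.2) (fun i => by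
        rw [hV, marg₁_empirical, marg₂_empirical]
        exact mul_pos (hx i) (hz i))
    rw [← hV, ← mutualInfo_eq_klSum] at h1
    simp only [] at h1
    have h2 : ∏ i, marg₁ V (x i) * marg₂ V (z i)
        = (∏ i, empirical hn x (x i)) * ∏ i, empirical hn z (z i) := by
      rw [← Finset.prod_mul_distrib]
      refine Finset.prod_congr rfl fun i _ => ?_
      rw [hV, marg₁_empirical, marg₂_empirical]
    rw [h2] at h1
    have hzz : 0 < ∏ i, empirical hn z (z i) := Finset.prod_pos fun i _ => hz i
    rw [Finset.prod_div_distrib, le_div_iff₀ hzz]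
    calc _ ≤ (∏ i, empirical hn x (x i)) * Real.exp (n * mutualInfo V) *
          ∏ i, empirical hn z (z i) := by
          refine mul_le_mul_of_nonneg_right (mul_le_mul_of_nonneg_right ?_ ?_) hzz.le
          · exact prod_le_prod_empirical hn x P
          · positivity
      _ = (∏ i, V (x i, z i)) := by
          rw [mul_right_comm, h1, mul_assoc, ← Real.exp_add]
          simp
  · rw [sum_prod_eq_prod_sum
      (fun i a => (empirical hn fun i => (x₀ i, z i)) (a, z i) / empirical hn z (z i))]
    refine (Finset.prod_eq_one fun i _ => ?_).le
    rw [← Finset.sum_div]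
    have := marg₂_empirical hn x₀ z (z i)
    rw [marg₂] at this
    rw [this, div_self (hz i).ne']

end

/-! ### Typical words -/

section
variable {X : Type*} [Fintype X]

lemma sum_prod_mul_sq_empirical_sub_le {n : ℕ} (hn : 0 < n) (P : stdSimplex ℝ X) (a : X) :
    ∑ x : Fin n → X, (∏ i, P (x i)) * (empirical hn x a - P a) ^ 2 ≤ 1 / n := by
  classical
  have hn' : (0 : ℝ) < n := by exact_mod_cast hn
  set u : X → ℝ := fun b => (if b = a then 1 else 0) - P a with hu
  have hP : ∑ b, P b = 1 := P.2.2
  have hmean : ∑ b, P b * u b = 0 := by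
    simp only [hu, mul_sub, Finset.sum_sub_distrib, ← Finset.sum_mul, hP]
    simp
  have hvar : ∑ b, P b * (u b * u b) ≤ 1 := by
    rw [← hP]
    refine Finset.sum_le_sum fun b _ => mul_le_of_le_one_right (P.2.1 b) ?_
    have h0 : 0 ≤ P a := P.2.1 a
    have h1 : P a ≤ 1 := by simp
    simp only [hu]
    split_ifs <;> nlinarith
  have hemp : ∀ x : Fin n → X, (empirical hn x a - P a) ^ 2
      = (∑ i, ∑ j, u (x i) * u (x j)) / (n : ℝ) ^ 2 := by
    intro x
    rw [← Finset.sum_mul_sum, ← sq, ← div_pow, empirical_apply]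
    congr 1
    simp only [hu, Finset.sum_sub_distrib, Finset.sum_const, Finset.card_univ, Fintype.card_fin,
      nsmul_eq_mul]
    field_simp
  -- Distinct coordinates are uncorrelated, so only the diagonal contributes.
  have hpair : ∀ i j : Fin n, ∑ x : Fin n → X, (∏ i, P (x i)) * (u (x i) * u (x j))
      ≤ if i = j then 1 else 0 := by
    intro i j
    split_ifs with h
    · subst h
      rw [sum_prod_mul_apply hP i (fun b => u b * u b)]
      exact hvar
    · rw [sum_prod_mul_apply₂ hP h (fun b c => u b * u c)]
      simp_rw [mul_left_comm _ (u _), ← Finset.mul_sum, hmean]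
      simp
  calc ∑ x : Fin n → X, (∏ i, P (x i)) * (empirical hn x a - P a) ^ 2
      = (∑ i, ∑ j, ∑ x : Fin n → X, (∏ i, P (x i)) * (u (x i) * u (x j))) / (n : ℝ) ^ 2 := by
        simp_rw [hemp, mul_div_assoc', ← Finset.sum_div, Finset.mul_sum]
        rw [Finset.sum_comm]
        simp_rw [Finset.sum_comm (s := (Finset.univ : Finset (Fin n → X)))]
    _ ≤ (∑ i : Fin n, ∑ j : Fin n, if i = j then (1 : ℝ) else 0) / (n : ℝ) ^ 2 := by
        gcongr with i _ j _
        exact hpair i j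
    _ = 1 / n := by
        simp
        field_simp

/-- A word is `ε`-typical for `P` if its empirical distribution is within `ε` of `P` in the
`ℓ¹` distance. -/
def IsTypical {n : ℕ} (hn : 0 < n) (P : stdSimplex ℝ X) (ε : ℝ) (x : Fin n → X) : Prop :=
  ∑ a, |empirical hn x a - P a| ≤ ε

open Classical in
/-- The weak law of large numbers, by Chebyshev's inequality. -/
lemma eventually_half_le_sum_isTypical (P : stdSimplex ℝ X) {ε : ℝ} (hε : 0 < ε) :
    ∀ᶠ n : ℕ in Filter.atTop, ∀ hn : 0 < n,
      1 / 2 ≤ ∑ x : Fin n → X, (∏ i, P (x i)) * (if IsTypical hn P ε x then 1 else 0) := by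
  have hlim : Filter.Tendsto (fun n : ℕ => (Fintype.card X : ℝ) ^ 2 / ε ^ 2 / n)
      Filter.atTop (nhds 0) := tendsto_const_div_atTop_nhds_zero_nat _
  filter_upwards [hlim.eventually_le_const (show (0 : ℝ) < 1 / 2 by norm_num)] with n h hn
  have hP : ∑ b, P b = 1 := P.2.2
  have htot : ∑ x : Fin n → X, ∏ i, P (x i) = 1 := sum_prod_eq_one hP
  have hw : ∀ x : Fin n → X, 0 ≤ ∏ i, P (x i) := fun x => Finset.prod_nonneg fun i _ => P.2.1 _
  set D : (Fin n → X) → ℝ := fun x => ∑ a, (empirical hn x a - P a) ^ 2 with hD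
  have hpt : ∀ x : Fin n → X, 1 - (Fintype.card X / ε ^ 2) * D x
      ≤ if IsTypical hn P ε x then 1 else 0 := by
    intro x
    have hD0 : 0 ≤ D x := Finset.sum_nonneg fun a _ => sq_nonneg _
    split_ifs with ht
    · have : 0 ≤ (Fintype.card X / ε ^ 2) * D x := by positivity
      linarith
    · have h1 : ε < ∑ a, |empirical hn x a - P a| := not_le.1 ht
      have h2 := sq_sum_le_card_mul_sum_sq (s := Finset.univ)
        (f := fun a => |empirical hn x a - P a|)
      simp only [sq_abs, Finset.card_univ] at h2
      have h3 : ε ^ 2 ≤ Fintype.card X * D x :=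
        le_trans (by gcongr) h2
      have : 1 ≤ (Fintype.card X / ε ^ 2) * D x := by
        rw [div_mul_eq_mul_div, le_div_iff₀ (by positivity)]
        linarith
      linarith
  have hmom : ∑ x : Fin n → X, (∏ i, P (x i)) * D x ≤ Fintype.card X / n := by
    simp only [hD, Finset.mul_sum]
    rw [Finset.sum_comm]
    refine (Finset.sum_le_sum fun a _ => sum_prod_mul_sq_empirical_sub_le hn P a).trans_eq ?_
    simp [div_eq_mul_inv]
  calc (1 : ℝ) / 2 ≤ 1 - Fintype.card X / ε ^ 2 * (Fintype.card X / n) := by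
        have : Fintype.card X / ε ^ 2 * (Fintype.card X / n)
          = (Fintype.card X : ℝ) ^ 2 / ε ^ 2 / n := by ring
        linarith
    _ ≤ 1 - Fintype.card X / ε ^ 2 * ∑ x : Fin n → X, (∏ i, P (x i)) * D x := by gcongr
    _ = ∑ x : Fin n → X, (∏ i, P (x i)) * (1 - (Fintype.card X / ε ^ 2) * D x) := by
        simp_rw [mul_sub, Finset.sum_sub_distrib, mul_one, htot, Finset.mul_sum]
        congr 1
        exact Finset.sum_congr rfl fun x _ => by ring
    _ ≤ _ := Finset.sum_le_sum fun x _ => mul_le_mul_of_nonneg_left (hpt x) (hw x)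

end

/-! ### Continuity and compactness -/

lemma continuous_stdSimplex_apply {A : Type*} [Fintype A] (a : A) :
    Continuous fun V : stdSimplex ℝ A => V a :=
  (continuous_apply a).comp continuous_subtype_val

lemma continuous_klSum {A : Type*} [Fintype A] (J : stdSimplex ℝ A) :
    Continuous fun V : stdSimplex ℝ A => klSum V J := by
  refine continuous_finsetSum _ fun a _ => ?_
  by_cases hJ : J a = 0
  · simp only [hJ, div_zero, Real.log_zero, mul_zero]
    exact continuous_const
  · have h : ∀ V : stdSimplex ℝ A, V a * Real.log (V a / J a)
        = V a * Real.log (V a) - V a * Real.log (J a) := by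
      intro V
      by_cases hV : V a = 0
      · simp [hV]
      · rw [Real.log_div hV hJ, mul_sub]
    simp_rw [h]
    exact (Real.continuous_mul_log.comp (continuous_stdSimplex_apply a)).sub
      ((continuous_stdSimplex_apply a).mul continuous_const)

section
variable {X Y : Type*} [Fintype X] [Fintype Y]

lemma continuous_marg₁ (x : X) : Continuous fun V : stdSimplex ℝ (X × Y) => marg₁ V x :=
  continuous_finsetSum _ fun _ _ => continuous_stdSimplex_apply _

lemma continuous_marg₂ (z : Y) : Continuous fun V : stdSimplex ℝ (X × Y) => marg₂ V z :=
  continuous_finsetSum _ fun _ _ => continuous_stdSimplex_apply _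

lemma continuous_expMetric (q : X → Y → ℝ) :
    Continuous fun V : stdSimplex ℝ (X × Y) => expMetric q V :=
  continuous_finsetSum _ fun _ _ => continuous_finsetSum _ fun _ _ =>
    (continuous_stdSimplex_apply _).mul continuous_const

lemma mutualInfo_eq_entropies (V : stdSimplex ℝ (X × Y)) :
    mutualInfo V = (∑ x, ∑ z, V (x, z) * Real.log (V (x, z)))
      - (∑ x, marg₁ V x * Real.log (marg₁ V x)) - ∑ z, marg₂ V z * Real.log (marg₂ V z) := by
  have h : ∀ x z, V (x, z) * Real.log (V (x, z) / (marg₁ V x * marg₂ V z))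
      = V (x, z) * Real.log (V (x, z)) - V (x, z) * Real.log (marg₁ V x)
        - V (x, z) * Real.log (marg₂ V z) := by
    intro x z
    rcases (V.2.1 (x, z)).eq_or_lt with h0 | h0
    · have : V (x, z) = 0 := h0.symm
      simp [this]
    · have hV : 0 < V (x, z) := h0
      have h1 : 0 < marg₁ V x := hV.trans_le (Finset.single_le_sum
        (f := fun z => V (x, z)) (fun z _ => V.2.1 (x, z)) (Finset.mem_univ z))
      have h2 : 0 < marg₂ V z := hV.trans_le (Finset.single_le_sum
        (f := fun x => V (x, z)) (fun x _ => V.2.1 (x, z)) (Finset.mem_univ x))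
      rw [Real.log_div hV.ne' (by positivity), Real.log_mul h1.ne' h2.ne']
      ring
  simp_rw [mutualInfo, h, Finset.sum_sub_distrib]
  congr 1
  · congr 1
    simp_rw [marg₁, Finset.sum_mul]
  · rw [Finset.sum_comm]
    simp_rw [marg₂, Finset.sum_mul]

lemma continuous_mutualInfo : Continuous fun V : stdSimplex ℝ (X × Y) => mutualInfo V := by
  simp_rw [mutualInfo_eq_entropies]
  refine (Continuous.sub ?_ ?_).sub ?_
  · exact continuous_finsetSum _ fun _ _ => continuous_finsetSum _ fun _ _ =>
      Real.continuous_mul_log.comp (continuous_stdSimplex_apply _)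
  · exact continuous_finsetSum _ fun x _ => Real.continuous_mul_log.comp (continuous_marg₁ x)
  · exact continuous_finsetSum _ fun z _ => Real.continuous_mul_log.comp (continuous_marg₂ z)

/-- Compactness: if the exponent exceeds `a` on all pairs with `X`-marginals equal to `P`, it does
so uniformly on all pairs with `X`-marginals close to `P`. Absolute continuity with respect to `J`
is kept as a constraint because it is a closed condition on which the divergence is continuous. -/
lemma exists_uniform_gap (P : stdSimplex ℝ X) (J : stdSimplex ℝ (X × Y)) (q : X → Y → ℝ)
    (R a : ℝ)
    (h : ∀ V V' : stdSimplex ℝ (X × Y), (∀ p, J p = 0 → V p = 0) → (∀ x, marg₁ V x = P x) →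
      (∀ x, marg₁ V' x = P x) → (∀ z, marg₂ V' z = marg₂ V z) → expMetric q V ≤ expMetric q V' →
      a < klSum V J + max 0 (mutualInfo V' - R)) :
    ∃ ε : ℝ, 0 < ε ∧ ∀ V V' : stdSimplex ℝ (X × Y), (∀ p, J p = 0 → V p = 0) →
      ∑ x, |marg₁ V x - P x| ≤ ε → ∑ x, |marg₁ V' x - P x| ≤ ε →
      (∀ z, marg₂ V' z = marg₂ V z) → expMetric q V ≤ expMetric q V' →
      a + ε ≤ klSum V J + max 0 (mutualInfo V' - R) := by
  set C : Set (stdSimplex ℝ (X × Y) × stdSimplex ℝ (X × Y)) :=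
    {w | (∀ p, J p = 0 → w.1 p = 0) ∧ (∀ z, marg₂ w.2 z = marg₂ w.1 z) ∧
      expMetric q w.1 ≤ expMetric q w.2} with hC
  set v : stdSimplex ℝ (X × Y) × stdSimplex ℝ (X × Y) → ℝ := fun w =>
    klSum w.1 J + max 0 (mutualInfo w.2 - R) with hv
  have hCc : IsCompact C := by
    refine IsClosed.isCompact ?_
    simp only [hC, Set.ofPred_and, Set.ofPred_forall]
    refine IsClosed.inter ?_ (IsClosed.inter ?_ ?_)
    · exact isClosed_iInter fun p => isClosed_iInter fun _ =>
        isClosed_eq ((continuous_stdSimplex_apply p).comp continuous_fst) continuous_const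
    · exact isClosed_iInter fun z => isClosed_eq ((continuous_marg₂ z).comp continuous_snd)
        ((continuous_marg₂ z).comp continuous_fst)
    · exact isClosed_le ((continuous_expMetric q).comp continuous_fst)
        ((continuous_expMetric q).comp continuous_snd)
  have hvc : Continuous v := ((continuous_klSum J).comp continuous_fst).add
    (continuous_const.max ((continuous_mutualInfo.comp continuous_snd).sub continuous_const))
  have hdev : Continuous fun V : stdSimplex ℝ (X × Y) => ∑ x, |marg₁ V x - P x| :=
    continuous_finsetSum _ fun x _ => ((continuous_marg₁ x).sub continuous_const).abs
  have hdev0 : ∀ V : stdSimplex ℝ (X × Y), 0 ≤ ∑ x, |marg₁ V x - P x| :=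
    fun V => Finset.sum_nonneg fun x _ => abs_nonneg _
  have hmarg : ∀ V : stdSimplex ℝ (X × Y), ∑ x, |marg₁ V x - P x| ≤ 0 →
      ∀ x, marg₁ V x = P x := by
    intro V hV x
    have := (Finset.sum_eq_zero_iff_of_nonneg fun x _ => abs_nonneg (marg₁ V x - P x)).1
      (le_antisymm hV (hdev0 V)) x (Finset.mem_univ x)
    exact sub_eq_zero.1 (abs_eq_zero.1 this)
  obtain ⟨m, hm0, hm⟩ := hCc.exists_forall_le'
    (f := fun w => max (v w - a) 0 + (∑ x, |marg₁ w.1 x - P x| + ∑ x, |marg₁ w.2 x - P x|))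
    (a := 0) ((((hvc.sub continuous_const).max continuous_const).add
      ((hdev.comp continuous_fst).add (hdev.comp continuous_snd))).continuousOn) (by
      rintro ⟨V, V'⟩ ⟨h1, h2, h3⟩
      have hV := hdev0 V
      have hV' := hdev0 V'
      have hmax : 0 ≤ max (v (V, V') - a) 0 := le_max_right _ _
      by_contra! hcon
      have := h V V' h1 (hmarg V (by linarith)) (hmarg V' (by linarith)) h2 h3
      have h4 : v (V, V') - a ≤ max (v (V, V') - a) 0 := le_max_left _ _
      simp only [hv] at h4
      simp only [hv] at hcon
      linarith)
  refine ⟨m / 3, by positivity, fun V V' h1 hV hV' h2 h3 => ?_⟩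
  have h4 := hm (V, V') ⟨h1, h2, h3⟩
  simp only at h4
  have h5 : m / 3 ≤ max (v (V, V') - a) 0 := by linarith
  rcases le_max_iff.1 h5 with h6 | h6
  · simp only [hv] at h6
    linarith
  · linarith

end

/-! ### The random coding bound -/

section
variable {X Y : Type*} [Fintype Y]

/-- The channel from `X` to `Z` obtained by pre-processing the output of `W` with `f`. -/
def cascade (W : Channel X Y) (f : Channel Y Y) (x : X) (z : Y) : ℝ := ∑ y, W x y * f y z

lemma cascade_nonneg (W : Channel X Y) (f : Channel Y Y) (x : X) (z : Y) :
    0 ≤ cascade W f x z :=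
  Finset.sum_nonneg fun y _ => mul_nonneg ((W x).2.1 y) ((f y).2.1 z)

open Classical in
lemma errorProb_eq (W : Channel X Y) {n : ℕ} (C : Code X n) (q : X → Y → ℝ) (f : Channel Y Y) :
    errorProb W C q f = ∑ m : Fin C.M, (1 / (C.M : ℝ)) * ∑ z : Fin n → Y,
      (∏ i, cascade W f (C.enc m i) (z i)) *
        (if ∃ k, k ≠ m ∧ addMetric q (C.enc m) z ≤ addMetric q (C.enc k) z then 1 else 0) := by
  unfold errorProb
  refine Finset.sum_congr rfl fun m _ => ?_
  congr 1
  simp_rw [Finset.mul_sum]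
  rw [Finset.sum_comm]
  refine Finset.sum_congr rfl fun z _ => ?_
  simp_rw [← mul_assoc]
  rw [← Finset.sum_mul]
  congr 1
  · simp_rw [cascade]
    rw [← sum_prod_eq_prod_sum (fun i y => W (C.enc m i) y * f y (z i))]
    exact Finset.sum_congr rfl fun y _ => Finset.prod_mul_distrib.symm
  · by_cases h : C.Correct q m z
    · have h2 : ¬ ∃ k, k ≠ m ∧ addMetric q (C.enc m) z ≤ addMetric q (C.enc k) z := by
        rintro ⟨k, hk, hle⟩
        exact (h k hk).not_ge hle
      simp [h, h2]
    · have h2 : ∃ k, k ≠ m ∧ addMetric q (C.enc m) z ≤ addMetric q (C.enc k) z := by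
        unfold Code.Correct at h
        push Not at h
        exact h
      rw [if_neg h, if_pos h2]

lemma errorProb_nonneg (W : Channel X Y) {n : ℕ} (C : Code X n) (q : X → Y → ℝ)
    (f : Channel Y Y) : 0 ≤ errorProb W C q f := by
  classical
  rw [errorProb_eq]
  exact Finset.sum_nonneg fun m _ => mul_nonneg (by positivity) <| Finset.sum_nonneg fun z _ =>
    mul_nonneg (Finset.prod_nonneg fun i _ => cascade_nonneg W f _ _) (by positivity)

end

section
variable {X Y : Type*} [Fintype X] [Fintype Y]

lemma jointXZ_apply (P : stdSimplex ℝ X) (W : Channel X Y) (f : Channel Y Y) (p : X × Y) :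
    jointXZ P W f p = P p.1 * cascade W f p.1 p.2 := by
  change ∑ y, P p.1 * W p.1 y * f y p.2 = _
  simp_rw [cascade, Finset.mul_sum, mul_assoc]

/-- The random coding bound at one block length. The codewords are drawn from the product
distribution `P ^ n` conditioned on the `ε`-typical words. -/
lemma exists_code_errorProb_le (W : Channel X Y) (f : Channel Y Y) (q : X → Y → ℝ)
    (P : stdSimplex ℝ X) {R β ε : ℝ} (hR : 0 ≤ R) {n : ℕ} (hn : 0 < n)
    (htyp : open Classical in 1 / 2 ≤ ∑ x : Fin n → X, (∏ i, P (x i)) *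
      (if IsTypical hn P ε x then 1 else 0))
    (hgap : ∀ V V' : stdSimplex ℝ (X × Y), (∀ p, jointXZ P W f p = 0 → V p = 0) →
      ∑ x, |marg₁ V x - P x| ≤ ε → ∑ x, |marg₁ V' x - P x| ≤ ε →
      (∀ z, marg₂ V' z = marg₂ V z) → expMetric q V ≤ expMetric q V' →
      β ≤ klSum V (jointXZ P W f) + max 0 (mutualInfo V' - R)) :
    ∃ C : Code X n, Real.exp (n * R) < C.M ∧ errorProb W C q f
      ≤ 8 * ((n : ℝ) + 1) ^ (2 * Fintype.card (X × Y)) * Real.exp (-(n * β)) := by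
  classical
  have hn' : (0 : ℝ) < n := by exact_mod_cast hn
  set J := jointXZ P W f with hJ
  set k := Fintype.card (X × Y)
  have hw : ∀ x : Fin n → X, 0 ≤ ∏ i, P (x i) := fun x => Finset.prod_nonneg fun i _ => P.2.1 _
  set S := ∑ x : Fin n → X, (∏ i, P (x i)) * (if IsTypical hn P ε x then (1 : ℝ) else 0) with hS
  have hS0 : 0 < S := lt_of_lt_of_le (by norm_num) htyp
  set Q : (Fin n → X) → ℝ := fun x =>
    (∏ i, P (x i)) * (if IsTypical hn P ε x then 1 else 0) / S with hQdef
  have hQ0 : ∀ x, 0 ≤ Q x := fun x =>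
    div_nonneg (mul_nonneg (hw x) (by positivity)) hS0.le
  have hQ1 : ∑ x, Q x = 1 := by
    simp only [hQdef]
    rw [← Finset.sum_div]
    exact div_self hS0.ne'
  have hQle : ∀ x, Q x ≤ 2 * ∏ i, P (x i) := by
    intro x
    simp only [hQdef]
    rw [div_le_iff₀ hS0]
    have := hw x
    split_ifs <;> nlinarith
  have hQtyp : ∀ x, Q x ≠ 0 → IsTypical hn P ε x ∧ ∏ i, P (x i) ≠ 0 := by
    intro x hx
    simp only [hQdef] at hx
    refine ⟨?_, ?_⟩
    · by_contra h
      simp [h] at hx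
    · intro h
      simp [h] at hx
  set K : (Fin n → X) → (Fin n → Y) → ℝ := fun x z => ∏ i, cascade W f (x i) (z i) with hK
  have hK0 : ∀ x z, 0 ≤ K x z := fun x z => Finset.prod_nonneg fun i _ => cascade_nonneg W f _ _
  have hPK : ∀ x z, (∏ i, P (x i)) * K x z = ∏ i, J (x i, z i) := by
    intro x z
    rw [hK, ← Finset.prod_mul_distrib]
    exact Finset.prod_congr rfl fun i _ => (jointXZ_apply P W f (x i, z i)).symm
  let E : (Fin n → X) → (Fin n → Y) → stdSimplex ℝ (X × Y) :=
    fun x z => empirical hn fun i => (x i, z i)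
  -- The factor `4` comes from `Q ≤ 2 P ^ n` and `M ≤ 2 exp (n R)`; the polynomial counts the joint
  -- empirical distributions of the competing words with `z`.
  set b : (Fin n → X) → (Fin n → Y) → ℝ := fun x z =>
    4 * ((n : ℝ) + 1) ^ k * Real.exp (-(n * (β - klSum (E x z) J))) with hb
  set M := ⌊Real.exp (n * R)⌋₊ + 1 with hM
  have hMle : (M : ℝ) ≤ 2 * Real.exp (n * R) := by
    have h1 := Nat.floor_le (Real.exp_pos (n * R)).le
    have h2 : 1 ≤ Real.exp (n * R) := Real.one_le_exp (by positivity)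
    rw [hM]
    push_cast
    linarith
  have hpoly : (1 : ℝ) ≤ ((n : ℝ) + 1) ^ k := one_le_pow₀ (by linarith)
  obtain ⟨c, hc⟩ := exists_code_of_union_bound hQ0 hQ1 hK0
    (fun x x' z => addMetric q x z ≤ addMetric q x' z) (b := b) M (Nat.succ_pos _) (by
      intro x z hQx hKx
      obtain ⟨htx, hPx⟩ := hQtyp x hQx
      have hac : ∀ p, J p = 0 → E x z p = 0 := by
        intro p hp
        by_contra hne
        obtain ⟨i, hi⟩ := exists_of_empirical_ne_zero hn hne
        refine mul_ne_zero hPx hKx ?_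
        rw [hPK]
        exact Finset.prod_eq_zero (Finset.mem_univ i) (by rw [hi, hp])
      rcases le_or_gt (β - klSum (E x z) J) 0 with h | h
      · left
        have : 1 ≤ Real.exp (-(n * (β - klSum (E x z) J))) :=
          Real.one_le_exp (by nlinarith)
        simp only [hb]
        nlinarith
      · right
        have hpt : ∀ x', Q x' * (if addMetric q x z ≤ addMetric q x' z then 1 else 0)
            ≤ 2 * Real.exp (-(n * (R + (β - klSum (E x z) J)))) *
              ((∏ i, P (x' i)) * Real.exp (n * mutualInfo (E x' z))) := by
          intro x'
          have hrhs : 0 ≤ 2 * Real.exp (-(n * (R + (β - klSum (E x z) J)))) *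
              ((∏ i, P (x' i)) * Real.exp (n * mutualInfo (E x' z))) :=
            mul_nonneg (by positivity) (mul_nonneg (hw x') (Real.exp_pos _).le)
          by_cases hQx' : Q x' = 0
          · rw [hQx', zero_mul]
            exact hrhs
          split_ifs with hbad
          · have hg := hgap (E x z) (E x' z) hac
              (by simpa only [E, marg₁_empirical, IsTypical] using htx)
              (by simpa only [E, marg₁_empirical, IsTypical] using (hQtyp x' hQx').1)
              (fun y => by simp only [E, marg₂_empirical])
              (by simpa only [E, expMetric_empirical] using hbad)
            -- Since the divergence alone is below `β`, the positive part is not `0`.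
            have hI : R + (β - klSum (E x z) J) ≤ mutualInfo (E x' z) := by
              rcases max_cases 0 (mutualInfo (E x' z) - R) with ⟨h1, -⟩ | ⟨h1, -⟩ <;>
                rw [h1] at hg <;> linarith
            have hexp : 1 ≤ Real.exp (-(n * (R + (β - klSum (E x z) J)))) *
                Real.exp (n * mutualInfo (E x' z)) := by
              rw [← Real.exp_add]
              refine Real.one_le_exp ?_
              nlinarith
            have h2 := hQle x'
            have h3 := mul_le_mul_of_nonneg_left hexp
              (mul_nonneg (zero_le_two (α := ℝ)) (hw x'))
            calc _ ≤ 2 * (∏ i, P (x' i)) * 1 := by linarith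
              _ ≤ _ := h3
              _ = _ := by ring
          · simpa using hrhs
        calc _ ≤ 2 * Real.exp (n * R) * ∑ x', 2 * Real.exp (-(n * (R + (β - klSum (E x z) J)))) *
              ((∏ i, P (x' i)) * Real.exp (n * mutualInfo (E x' z))) := by
              refine mul_le_mul hMle (Finset.sum_le_sum fun x' _ => hpt x') ?_ (by positivity)
              exact Finset.sum_nonneg fun x' _ => mul_nonneg (hQ0 x') (by positivity)
          _ ≤ 2 * Real.exp (n * R) * (2 * Real.exp (-(n * (R + (β - klSum (E x z) J)))) *
              ((n : ℝ) + 1) ^ k) := by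
              rw [← Finset.mul_sum]
              gcongr
              exact sum_prod_mul_exp_mutualInfo_le hn P z
          _ = b x z := by
              have : Real.exp (-(n * (R + (β - klSum (E x z) J))))
                  = Real.exp (-(n * R)) * Real.exp (-(n * (β - klSum (E x z) J))) := by
                rw [← Real.exp_add]
                congr 1
                ring
              have h0 : Real.exp (n * R) * Real.exp (-(n * R)) = 1 := by
                rw [← Real.exp_add, add_neg_cancel, Real.exp_zero]
              simp only [hb]
              rw [this]
              linear_combination (4 * Real.exp (-(n * (β - klSum (E x z) J))) *
                ((n : ℝ) + 1) ^ k) * h0)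
  refine ⟨⟨M, c⟩, ?_, ?_⟩
  · change Real.exp (n * R) < (M : ℝ)
    rw [hM]
    push_cast
    exact Nat.lt_floor_add_one _
  rw [errorProb_eq]
  refine hc.trans ?_
  calc ∑ x, Q x * ∑ z, K x z * b x z
      ≤ ∑ x : Fin n → X, (2 * ∏ i, P (x i)) * ∑ z, K x z * b x z := by
        refine Finset.sum_le_sum fun x _ => mul_le_mul_of_nonneg_right (hQle x) ?_
        exact Finset.sum_nonneg fun z _ => mul_nonneg (hK0 x z) (by positivity)
    _ = ∑ x : Fin n → X, ∑ z : Fin n → Y, 8 * ((n : ℝ) + 1) ^ k * Real.exp (-(n * β)) *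
          ((∏ i, J (x i, z i)) * Real.exp (n * klSum (E x z) J)) := by
        refine Finset.sum_congr rfl fun x _ => ?_
        rw [Finset.mul_sum]
        refine Finset.sum_congr rfl fun z _ => ?_
        have : Real.exp (-(n * (β - klSum (E x z) J)))
            = Real.exp (-(n * β)) * Real.exp (n * klSum (E x z) J) := by
          rw [← Real.exp_add]
          congr 1
          ring
        rw [← hPK]
        simp only [hb]
        rw [this]
        ring
    _ = 8 * ((n : ℝ) + 1) ^ k * Real.exp (-(n * β)) *
          ∑ s : Fin n → X × Y, (∏ i, J (s i)) * Real.exp (n * klSum (empirical hn s) J) := by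
        simp_rw [← Finset.mul_sum]
        congr 1
        rw [← Fintype.sum_prod_type', ← (Equiv.arrowProdEquivProdArrow (Fin n) (fun _ => X)
          (fun _ => Y)).sum_comp]
        rfl
    _ ≤ 8 * ((n : ℝ) + 1) ^ k * Real.exp (-(n * β)) * ((n : ℝ) + 1) ^ k := by
        gcongr
        exact sum_prod_mul_exp_klSum_le hn J
    _ = _ := by ring

/-- If the exponent of every admissible pair exceeds `a`, there are codes of rate `R` whose error
probability decays exponentially with an exponent larger than `a`. -/
lemma exists_codes_of_lt_exponent [Nonempty X] (W : Channel X Y) (f : Channel Y Y) (q : X → Y → ℝ)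
    (P : stdSimplex ℝ X) (R a : ℝ)
    (h : ∀ V V' : stdSimplex ℝ (X × Y), (∀ p, jointXZ P W f p = 0 → V p = 0) →
      (∀ x, marg₁ V x = P x) → (∀ x, marg₁ V' x = P x) → (∀ z, marg₂ V' z = marg₂ V z) →
      expMetric q V ≤ expMetric q V' →
      a < klSum V (jointXZ P W f) + max 0 (mutualInfo V' - R)) :
    ∃ (b : ℝ) (C : (n : ℕ) → Code X n), a < b ∧ (∀ n : ℕ, Real.exp (n * R) < (C n).M) ∧
      ∀ᶠ n in Filter.atTop, errorProb W (C n) q f ≤ Real.exp (-(n * b)) := by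
  classical
  -- At the remaining block lengths any code with sufficiently many messages will do.
  suffices hmain : ∃ b, a < b ∧ ∀ᶠ n : ℕ in Filter.atTop, ∃ C : Code X n,
      Real.exp (n * R) < C.M ∧ errorProb W C q f ≤ Real.exp (-(n * b)) by
    obtain ⟨b, hab, hev⟩ := hmain
    have hall : ∀ n : ℕ, ∃ C : Code X n, Real.exp (n * R) < C.M ∧
        ((∃ C' : Code X n, Real.exp (n * R) < C'.M ∧ errorProb W C' q f ≤ Real.exp (-(n * b))) →
          errorProb W C q f ≤ Real.exp (-(n * b))) := by
      intro n
      by_cases hC : ∃ C' : Code X n, Real.exp (n * R) < C'.M ∧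
          errorProb W C' q f ≤ Real.exp (-(n * b))
      · obtain ⟨C, h1, h2⟩ := hC
        exact ⟨C, h1, fun _ => h2⟩
      · obtain ⟨M, hM⟩ := exists_nat_gt (Real.exp (n * R))
        exact ⟨⟨M, fun _ _ => Classical.arbitrary X⟩, hM, fun h => absurd h hC⟩
    choose C hC1 hC2 using hall
    exact ⟨b, C, hab, hC1, hev.mono fun n hn => hC2 n hn⟩
  rcases lt_or_ge R 0 with hR | hR
  · -- At a negative rate a single message suffices, and it is never confused.
    refine ⟨a + 1, by linarith, ?_⟩
    filter_upwards [Filter.eventually_gt_atTop 0] with n hn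
    refine ⟨⟨1, fun _ _ => Classical.arbitrary X⟩, ?_, ?_⟩
    · have : (0 : ℝ) < n := by exact_mod_cast hn
      have h2 : (n : ℝ) * R < 0 := mul_neg_of_pos_of_neg this hR
      simpa using h2
    · refine le_trans (le_of_eq ?_) (Real.exp_pos _).le
      rw [errorProb_eq]
      refine Finset.sum_eq_zero fun m _ => ?_
      refine mul_eq_zero_of_right _ (Finset.sum_eq_zero fun z _ => mul_eq_zero_of_right _ ?_)
      rw [if_neg]
      rintro ⟨j, hj, -⟩
      exact hj (Subsingleton.elim (α := Fin 1) _ _)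
  obtain ⟨ε, hε, hgap⟩ := exists_uniform_gap P (jointXZ P W f) q R a h
  refine ⟨a + ε / 2, by linarith, ?_⟩
  -- Half of the gap absorbs the polynomial factor.
  have hlim : Filter.Tendsto (fun n : ℕ => 8 * ((n : ℝ) + 1) ^ (2 * Fintype.card (X × Y)) *
      Real.exp (-(n * (ε / 2)))) Filter.atTop (nhds 0) := by
    set d := 2 * Fintype.card (X × Y)
    have h1 := (Real.tendsto_pow_mul_exp_neg_atTop_nhds_zero d).comp
      ((tendsto_natCast_atTop_atTop.atTop_add (tendsto_const_nhds (x := (1 : ℝ))) :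
        Filter.Tendsto (fun n : ℕ => (n : ℝ) + 1) Filter.atTop Filter.atTop).const_mul_atTop
          (half_pos hε))
    have h2 := h1.const_mul (8 * Real.exp (ε / 2) * ((ε / 2) ^ d)⁻¹)
    rw [mul_zero] at h2
    refine h2.congr fun n => ?_
    have : Real.exp (-(n * (ε / 2))) = Real.exp (ε / 2) * Real.exp (-(ε / 2 * (n + 1))) := by
      rw [← Real.exp_add]
      congr 1
      ring
    have h0 : (ε / 2) ^ d ≠ 0 := (pow_pos (half_pos hε) d).ne'
    simp only [Function.comp]
    rw [this, mul_pow]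
    field_simp
  filter_upwards [eventually_half_le_sum_isTypical P hε, Filter.eventually_gt_atTop 0,
    hlim.eventually_le_const zero_lt_one] with n htyp hn hle
  obtain ⟨C, hC1, hC2⟩ := exists_code_errorProb_le W f q P hR hn (htyp hn) hgap
  refine ⟨C, hC1, hC2.trans ?_⟩
  have : Real.exp (-(n * (a + ε))) = Real.exp (-(n * (ε / 2))) * Real.exp (-(n * (a + ε / 2))) := by
    rw [← Real.exp_add]
    congr 1
    ring
  rw [this, ← mul_assoc]
  exact mul_le_of_le_one_left (Real.exp_pos _).le hle

end

/-! ### Capacity -/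

section
variable {X Y : Type*} [Fintype Y]

lemma IsAchievableFixed.isAchievable {W : Channel X Y} {q : X → Y → ℝ} {R : ℝ}
    (h : IsAchievableFixed W q R) : IsAchievable W q R := by
  obtain ⟨hR, C, f, hC, hlim⟩ := h
  refine ⟨hR, C, hC, squeeze_zero (fun n => Real.iInf_nonneg fun f => errorProb_nonneg W _ q f)
    (fun n => ciInf_le ?_ f) hlim⟩
  exact ⟨0, Set.forall_mem_range.2 fun f => errorProb_nonneg W _ q f⟩

lemma capacityFixed_le_capacity (W : Channel X Y) (q : X → Y → ℝ) :
    capacityFixed W q ≤ capacity W q :=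
  iSup₂_le fun R hR => le_iSup₂_of_le R hR.isAchievable le_rfl

end

section
variable {X Y : Type*} [Fintype X] [Fintype Y]

lemma lmRate_le_capacityFixed [Nonempty X] (W : Channel X Y) (q : X → Y → ℝ) :
    lmRate W q ≤ capacityFixed W q := by
  refine le_of_forall_lt_imp_le_of_dense fun r hr => ?_
  rcases eq_or_ne r 0 with rfl | hr0
  · exact zero_le
  obtain ⟨P, hP⟩ := lt_iSup_iff.1 hr
  obtain ⟨f, hf⟩ := lt_iSup_iff.1 hP
  have hrtop : r ≠ ⊤ := hf.ne_top
  have hrpos : 0 < r.toReal := ENNReal.toReal_pos hr0 hrtop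
  obtain ⟨b, C, hb, hC, hev⟩ := exists_codes_of_lt_exponent W f q P r.toReal 0 (by
    intro V V' hac hV hV' hZ hq
    obtain ⟨h0, heq⟩ := klSum_nonneg V.2.1 (jointXZ P W f).2.1 V.2.2 (jointXZ P W f).2.2.le hac
    by_contra! hcon
    have hm := le_max_left 0 (mutualInfo V' - r.toReal)
    have hm' := le_max_right 0 (mutualInfo V' - r.toReal)
    -- A vanishing divergence identifies `V` with the law of `(X, Z)`.
    have hVJ : V = jointXZ P W f := Subtype.ext (heq (by
      change klSum V (jointXZ P W f) ≤ 0
      linarith))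
    change 0 ≤ klSum V (jointXZ P W f) at h0
    subst hVJ
    have h1 : r < ENNReal.ofReal (mutualInfo V') :=
      hf.trans_le (iInf_le_of_le V' (iInf_le_of_le hV' (iInf_le_of_le hZ (iInf_le _ hq))))
    have h2 := (ENNReal.lt_ofReal_iff_toReal_lt hrtop).1 h1
    linarith)
  have hach : IsAchievableFixed W q r.toReal := by
    refine ⟨hrpos, C, f, hC, ?_⟩
    refine tendsto_of_tendsto_of_tendsto_of_le_of_le' tendsto_const_nhds
      (h := fun n : ℕ => Real.exp (-(n * b))) ?_
      (Filter.Eventually.of_forall fun n => errorProb_nonneg W _ q f) hev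
    exact Real.tendsto_exp_neg_atTop_nhds_zero.comp
      (tendsto_natCast_atTop_atTop.atTop_mul_const hb)
  calc r = ENNReal.ofReal r.toReal := (ENNReal.ofReal_toReal hrtop).symm
    _ ≤ _ := le_iSup₂_of_le (f := fun (R : ℝ) (_ : IsAchievableFixed W q R) => ENNReal.ofReal R)
      r.toReal hach le_rfl

/-! ### Reliability function -/

lemma lmExponent_le_reliability [Nonempty X] (R : ℝ) (W : Channel X Y) (q : X → Y → ℝ) :
    lmExponent R W q ≤ reliability R W q := by
  refine le_of_forall_lt_imp_le_of_dense fun r hr => ?_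
  obtain ⟨f, hf⟩ := lt_iSup_iff.1 hr
  obtain ⟨P, hP⟩ := lt_iSup_iff.1 hf
  have hrtop : r ≠ ⊤ := hP.ne_top
  obtain ⟨b, C, hb, hC, hev⟩ := exists_codes_of_lt_exponent W f q P R r.toReal (by
    intro V V' hac hV hV' hZ hq
    have h0 := (klSum_nonneg V.2.1 (jointXZ P W f).2.1 V.2.2 (jointXZ P W f).2.2.le hac).1
    change 0 ≤ klSum V (jointXZ P W f) at h0
    have h1 : r < relEntropy V (jointXZ P W f) + ENNReal.ofReal (mutualInfo V' - R) :=
      hP.trans_le (iInf_le_of_le V (iInf_le_of_le V' (iInf_le_of_le hV (iInf_le_of_le hV'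
        (iInf_le_of_le hZ (iInf_le _ hq))))))
    have h2 : relEntropy V (jointXZ P W f) = ENNReal.ofReal (klSum V (jointXZ P W f)) := by
      rw [relEntropy, if_pos hac]
      rfl
    have h3 : ENNReal.ofReal (mutualInfo V' - R)
        = ENNReal.ofReal (max 0 (mutualInfo V' - R)) := by
      rcases le_total 0 (mutualInfo V' - R) with h | h
      · rw [max_eq_right h]
      · rw [max_eq_left h, ENNReal.ofReal_of_nonpos h, ENNReal.ofReal_zero]
    rw [h2, h3, ← ENNReal.ofReal_add h0 (le_max_left _ _)] at h1
    exact (ENNReal.lt_ofReal_iff_toReal_lt hrtop).1 h1)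
  have hach : IsAchievableExponent W q f R r := by
    intro δ hδ
    refine ⟨C, fun n => le_trans (Real.exp_le_exp.2 ?_) (hC n).le, ?_⟩
    · exact mul_le_mul_of_nonneg_left (by linarith) (Nat.cast_nonneg n)
    · refine Filter.le_limsup_of_frequently_le (Filter.Eventually.frequently ?_)
      filter_upwards [hev, Filter.eventually_gt_atTop 0] with n hn hnpos
      have hn' : (0 : ℝ) < n := by exact_mod_cast hnpos
      have hlog : ENNReal.log (ENNReal.ofReal (errorProb W (C n) q f)) ≤
          ((-(n * b) : ℝ) : EReal) := by
        refine (ENNReal.log_le_log (ENNReal.ofReal_le_ofReal hn)).trans_eq ?_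
        rw [ENNReal.log_ofReal_of_pos (Real.exp_pos _), Real.log_exp]
      have hmul : ((1 / (n : ℝ) : ℝ) : EReal) *
          ENNReal.log (ENNReal.ofReal (errorProb W (C n) q f)) ≤ ((-b : ℝ) : EReal) := by
        refine (mul_le_mul_of_nonneg_left hlog
          (EReal.coe_nonneg.2 (by positivity))).trans_eq ?_
        rw [← EReal.coe_mul]
        congr 1
        field_simp
      calc (r : EReal) = ((r.toReal : ℝ) : EReal) := (EReal.coe_ennreal_toReal hrtop).symm
        _ ≤ ((b : ℝ) : EReal) := EReal.coe_le_coe_iff.2 hb.le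
        _ = -((-b : ℝ) : EReal) := by rw [EReal.coe_neg, neg_neg]
        _ ≤ _ := EReal.neg_le_neg_iff.2 hmul
  exact le_iSup_of_le f (le_iSup₂_of_le (f := fun (E : ℝ≥0∞)
    (_ : IsAchievableExponent W q f R E) => E) r hach le_rfl)

end

end MismatchPre
end

theorem mainTheorem1 {X Y : Type*} [Fintype X] [Nonempty X] [Fintype Y]
    (W : MismatchPre.Channel X Y) (q : X → Y → ℝ) :
    (MismatchPre.lmRate W q ≤ MismatchPre.capacity W q ∧
      MismatchPre.lmRate W q ≤ MismatchPre.capacityFixed W q) ∧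
    ∀ R : ℝ, MismatchPre.lmExponent R W q ≤ MismatchPre.reliability R W q := by
  have h := MismatchPre.lmRate_le_capacityFixed W q
  exact ⟨⟨h.trans (MismatchPre.capacityFixed_le_capacity W q), h⟩,
    fun R => MismatchPre.lmExponent_le_reliability R W q⟩
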